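/- Let $n,d\ge 0$ and $\ell\ge 1$ be integers, and let $f:\{\pm1\}^n\to[-1,1]$. For $S\subseteq[n]$ write $\chi_S(x)=\prod_{j\in S}x_j$, and let $\hat f(S)$ be the Fourier coefficients of $f$, i.e. the unique real numbers with $f(x)=\sum_{S\subseteq[n]}\hat f(S)\,\chi_S(x)$ for all $x\in\{\pm1\}^n$. Suppose that $f$ has degree at most $d$, that is, $\hat f(S)=0$ whenever $|S|>d$. Then $$\|\hat f_\ell\|_1:=\sum_{S\subseteq[n],\,|S|=\ell}|\hat f(S)|\;\le\; n^{\frac{\ell-1}{2}}\cdot d^{\ell}\cdot e^{\binom{\ell+1}{2}}.$$ -/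

import Mathlib

namespace BooleanCube

/-- The discrete cube `{±1}^n`; the units of `ℤ` are exactly `1` and `-1`. -/
abbrev Cube (n : ℕ) : Type := Fin n → ℤˣ

/-- The character `χ_S(x) = ∏_{j ∈ S} x_j`, as a real number. -/
def chi {n : ℕ} (S : Finset (Fin n)) (x : Cube n) : ℝ :=
  ∏ j ∈ S, (((x j : ℤˣ) : ℤ) : ℝ)

/-- The Fourier coefficient `f̂(S) = 𝔼[f(X) χ_S(X)]`, with `X` uniform on `{±1}^n`.
By `sum_fourierCoeff_mul_chi` and `fourierCoeff_unique` below, these are the coefficients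
of the unique expansion of `f` in the characters. -/
noncomputable def fourierCoeff {n : ℕ} (f : Cube n → ℝ) (S : Finset (Fin n)) : ℝ :=
  (∑ x : Cube n, f x * chi S x) / 2 ^ n

/-- The degree of `f`, i.e. the degree of its multilinear polynomial: the largest `|S|` with
`f̂(S) ≠ 0` (and `0` for `f = 0`). -/
noncomputable def degree {n : ℕ} (f : Cube n → ℝ) : ℕ :=
  sSup {k : ℕ | ∃ S : Finset (Fin n), fourierCoeff f S ≠ 0 ∧ S.card = k}

/-- The level-`ℓ` Fourier `ℓ₁`-norm `‖f̂_ℓ‖₁ = ∑_{|S| = ℓ} |f̂(S)|`. -/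
noncomputable def levelL1Norm {n : ℕ} (f : Cube n → ℝ) (l : ℕ) : ℝ :=
  ∑ S ∈ (Finset.univ : Finset (Fin n)).powersetCard l, |fourierCoeff f S|

theorem sum_chi_mul_chi {n : ℕ} (S T : Finset (Fin n)) :
    ∑ x : Cube n, chi S x * chi T x = if S = T then 2 ^ n else 0 := by
  have h : ∀ x : Cube n, chi S x * chi T x =
      ∏ i, ((if i ∈ S then (((x i : ℤˣ) : ℤ) : ℝ) else 1) *
        (if i ∈ T then (((x i : ℤˣ) : ℤ) : ℝ) else 1)) := by
    intro x
    rw [Finset.prod_mul_distrib]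
    simp [chi, Finset.prod_ite_mem]
  have hu : (Finset.univ : Finset ℤˣ) = {1, -1} := rfl
  have e := Finset.prod_univ_sum (fun _ : Fin n => (Finset.univ : Finset ℤˣ))
    (fun i u => (if i ∈ S then ((u : ℤ) : ℝ) else 1) * (if i ∈ T then ((u : ℤ) : ℝ) else 1))
  rw [Fintype.piFinset_univ] at e
  rw [Finset.sum_congr rfl fun x _ => h x, ← e]
  split_ifs with hST
  · subst hST
    rw [Finset.prod_congr rfl (g := fun _ => (2 : ℝ))]
    · simp
    · intro i _
      by_cases hi : i ∈ S <;> simp [hu, hi] <;> norm_num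
  · obtain ⟨i, hi⟩ : ∃ i, ¬ (i ∈ S ↔ i ∈ T) := by
      by_contra! hc
      exact hST (Finset.ext hc)
    apply Finset.prod_eq_zero (Finset.mem_univ i)
    by_cases hS : i ∈ S <;> by_cases hT : i ∈ T <;> simp_all

theorem fourierCoeff_unique {n : ℕ} (f : Cube n → ℝ) (c : Finset (Fin n) → ℝ)
    (h : ∀ x, f x = ∑ S, c S * chi S x) (T : Finset (Fin n)) : fourierCoeff f T = c T := by
  have : ∑ x : Cube n, f x * chi T x = c T * 2 ^ n := by
    simp_rw [h, Finset.sum_mul]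
    rw [Finset.sum_comm]
    simp_rw [mul_assoc, ← Finset.mul_sum, sum_chi_mul_chi]
    simp
  rw [fourierCoeff, this]
  field_simp

theorem sum_fourierCoeff_mul_chi {n : ℕ} (f : Cube n → ℝ) (x : Cube n) :
    f x = ∑ S, fourierCoeff f S * chi S x := by
  have key : ∀ y : Cube n, ∑ S, chi S y * chi S x = if y = x then 2 ^ n else 0 := by
    intro y
    have h : ∑ S, chi S y * chi S x =
        ∏ i, (1 + (((y i : ℤˣ) : ℤ) : ℝ) * (((x i : ℤˣ) : ℤ) : ℝ)) := by
      rw [Finset.prod_one_add]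
      simp [chi, Finset.prod_mul_distrib]
    rw [h]
    split_ifs with hy
    · subst hy
      rw [Finset.prod_congr rfl (g := fun _ => (2 : ℝ))]
      · simp
      · intro i _
        rcases Int.units_eq_one_or (y i) with hi | hi <;> simp [hi] <;> norm_num
    · obtain ⟨i, hi⟩ := Function.ne_iff.mp hy
      apply Finset.prod_eq_zero (Finset.mem_univ i)
      rcases Int.units_eq_one_or (y i) with h1 | h1 <;>
        rcases Int.units_eq_one_or (x i) with h2 | h2 <;> simp_all
  simp_rw [fourierCoeff, div_mul_eq_mul_div, Finset.sum_mul]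
  rw [← Finset.sum_div, Finset.sum_comm]
  simp_rw [mul_assoc, ← Finset.mul_sum, key]
  simp

theorem degree_le_iff {n : ℕ} (f : Cube n → ℝ) (d : ℕ) :
    degree f ≤ d ↔ ∀ S : Finset (Fin n), d < S.card → fourierCoeff f S = 0 := by
  have hb : BddAbove {k : ℕ | ∃ S : Finset (Fin n), fourierCoeff f S ≠ 0 ∧ S.card = k} := by
    refine ⟨n, ?_⟩
    rintro k ⟨S, -, rfl⟩
    simpa using Finset.card_le_univ S
  constructor
  · intro h S hS
    by_contra hne
    have : S.card ≤ degree f := le_csSup hb ⟨S, hne, rfl⟩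
    omega
  · intro h
    apply csSup_le'
    rintro k ⟨S, hS, rfl⟩
    by_contra hk
    exact hS (h S (by omega))

end BooleanCube

/-! Induction on `l`, through the multilinear extension F of f, bounded by 1 on [-1,1]^n. Level one
is the derivative of F at 0 along a sign vector, so Bernstein's inequality at the origin, proved by
a Fejér quadrature, gives 2d (`abs_coeff_one_le`). For level `l + 1`, group the coefficients as
`insert j T` with `|T| = l`. For fixed T, Cauchy-Schwarz and Khintchine bound the sum over j by
√n·√e times the mean over sign vectors x of the derivative at 0 of r ↦ ∂_T F(rx). For each x with
|r| ≤ 1/2, the sum of |∂_T F(rx)| over T is at most 2^l times the level-`l` bound, because y ↦ F(rx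
+ y/2) is again bounded of degree at most d (`sum_abs_extDeriv_le`). Bernstein in ℓ¹ then costs 4d,
and the numerical constants fit inside e^(l+1). -/

namespace BooleanCube

/-! ### Bernstein's inequality at the origin -/

open Polynomial in
/-- A linear functional vanishing on the Chebyshev polynomials of index at most `d` vanishes on
all polynomials of degree at most `d`. -/
theorem eq_zero_of_chebyshev_eq_zero (φ : ℝ[X] →ₗ[ℝ] ℝ) (d : ℕ)
    (h : ∀ j : ℕ, j ≤ d → φ (Chebyshev.T ℝ j) = 0) (p : ℝ[X]) (hp : p.natDegree ≤ d) :
    φ p = 0 := by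
  induction d generalizing p with
  | zero =>
    have h0 := h 0 le_rfl
    rw [eq_C_of_natDegree_le_zero hp, ← mul_one (C _), ← smul_eq_C_mul, map_smul]
    simp at h0
    simp [h0]
  | succ d ih =>
    have hT : (Chebyshev.T ℝ ((d + 1 : ℕ) : ℤ)).natDegree = d + 1 := by
      rw [Chebyshev.natDegree_T]; rfl
    set c := (Chebyshev.T ℝ ((d + 1 : ℕ) : ℤ)).coeff (d + 1) with hc
    have hc0 : c ≠ 0 := by
      have := leadingCoeff_ne_zero.mpr (Chebyshev.T_ne_zero ℝ ((d + 1 : ℕ) : ℤ))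
      rwa [leadingCoeff, hT] at this
    have hq : (p - (p.coeff (d + 1) / c) • Chebyshev.T ℝ ((d + 1 : ℕ) : ℤ)).natDegree ≤ d := by
      rw [natDegree_le_iff_coeff_eq_zero]
      intro N hN
      rcases (Nat.succ_le_of_lt hN).eq_or_lt with rfl | hN'
      · simp only [coeff_sub, coeff_smul, smul_eq_mul]
        rw [Nat.succ_eq_add_one, ← hc]
        field_simp
        ring
      · simp only [coeff_sub, coeff_smul, smul_eq_mul]
        rw [coeff_eq_zero_of_natDegree_lt (p := p) (by omega),
          coeff_eq_zero_of_natDegree_lt (p := Chebyshev.T ℝ _) (hT.trans_lt hN'), mul_zero, sub_zero]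
    have := ih (fun j hj => h j (by omega)) _ hq
    rw [map_sub, map_smul, h _ le_rfl, smul_zero, sub_zero] at this
    exact this

/-- T_j' = j·U_{j-1}, and U_{j-1} is evaluated at 0 = cos(π/2). -/
theorem coeff_one_chebyshev_T (j : ℕ) :
    (Polynomial.Chebyshev.T ℝ j).coeff 1 = j * Real.sin (j * (Real.pi / 2)) := by
  have h := Polynomial.Chebyshev.U_real_cos (Real.pi / 2) ((j : ℤ) - 1)
  have h1 := Polynomial.coeff_derivative (Polynomial.Chebyshev.T ℝ j) 0
  rw [Polynomial.coeff_zero_eq_eval_zero, Polynomial.Chebyshev.T_derivative_eq_U] at h1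
  simp at h h1
  rw [← h1, h]

theorem sum_zpow_of_isPrimitiveRoot {N : ℕ} {ζ : ℂ} (hζ : IsPrimitiveRoot ζ N) (e : ℤ) :
    ∑ k ∈ Finset.range N, (ζ ^ k) ^ e = if (N : ℤ) ∣ e then (N : ℂ) else 0 := by
  have hc : ∀ k : ℕ, (ζ ^ k) ^ e = (ζ ^ e) ^ k := fun k => by
    rw [← zpow_natCast, ← zpow_natCast, zpow_comm]
  simp_rw [hc]
  split_ifs with h
  · rw [(hζ.zpow_eq_one_iff_dvd e).mpr h]
    simp
  · have h1 : ζ ^ e ≠ 1 := fun h' => h ((hζ.zpow_eq_one_iff_dvd e).mp h')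
    rw [geom_sum_eq h1]
    have : (ζ ^ e) ^ N = 1 := by
      rw [← zpow_natCast, zpow_comm, zpow_natCast, hζ.pow_eq_one, one_zpow]
    simp [this]

/-- The unnormalised Fejér kernel `|1 + z + ⋯ + z^(d-1)|²`. -/
noncomputable def fejer (d : ℕ) (z : ℂ) : ℝ := Complex.normSq (∑ m ∈ Finset.range d, z ^ m)

theorem fejer_nonneg (d : ℕ) (z : ℂ) : 0 ≤ fejer d z := Complex.normSq_nonneg _

theorem fejer_eq_sum (d : ℕ) {z : ℂ} (hz : ‖z‖ = 1) :
    (fejer d z : ℂ) = ∑ m ∈ Finset.range d, ∑ m' ∈ Finset.range d, z ^ ((m : ℤ) - m') := by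
  have h0 : z ≠ 0 := by rintro rfl; simp at hz
  have hinv : (starRingEnd ℂ) z = z⁻¹ := by
    rw [Complex.inv_def, Complex.normSq_eq_norm_sq, hz]; simp
  rw [fejer, ← Complex.mul_conj, map_sum, Finset.sum_mul_sum]
  refine Finset.sum_congr rfl fun m _ => Finset.sum_congr rfl fun m' _ => ?_
  rw [map_pow, hinv, zpow_sub₀ h0, zpow_natCast, zpow_natCast, inv_pow, div_eq_mul_inv]

/-- Orthogonality of the N-th roots of unity keeps only the pairs with m' = e + m: since |e + m -
m'| < N, no other frequency aliases to 0. The truncated subtraction counts these pairs, giving 0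
once |e| ≥ d. -/
theorem sum_zpow_mul_fejer {d N : ℕ} {ζ : ℂ} (hζ : IsPrimitiveRoot ζ N) (hN : N ≠ 0)
    (e : ℤ) (he : |e| + d ≤ N) :
    ∑ k ∈ Finset.range N, (ζ ^ k) ^ e * (fejer d (ζ ^ k) : ℂ) = N * ((d - e.natAbs : ℕ) : ℂ) := by
  have hnorm : ‖ζ‖ = 1 := hζ.norm'_eq_one hN
  have h0 : ζ ≠ 0 := by rintro rfl; simp at hnorm
  have h1 : ∀ k : ℕ, (ζ ^ k) ^ e * (fejer d (ζ ^ k) : ℂ) =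
      ∑ m ∈ Finset.range d, ∑ m' ∈ Finset.range d, (ζ ^ k) ^ (e + ((m : ℤ) - m')) := by
    intro k
    rw [fejer_eq_sum d (by simp [hnorm]), Finset.mul_sum]
    refine Finset.sum_congr rfl fun m _ => ?_
    rw [Finset.mul_sum]
    exact Finset.sum_congr rfl fun m' _ => (zpow_add₀ (pow_ne_zero _ h0) _ _).symm
  simp_rw [h1]
  rw [Finset.sum_comm]
  have h2 : ∀ m ∈ Finset.range d, ∑ k ∈ Finset.range N, ∑ m' ∈ Finset.range d,
      (ζ ^ k) ^ (e + ((m : ℤ) - m')) =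
      if 0 ≤ e + (m : ℤ) ∧ e + (m : ℤ) < d then (N : ℂ) else 0 := by
    intro m hm
    rw [Finset.mem_range] at hm
    rw [Finset.sum_comm]
    simp_rw [sum_zpow_of_isPrimitiveRoot hζ]
    have h3 : ∀ m' ∈ Finset.range d,
        (if (N : ℤ) ∣ e + ((m : ℤ) - m') then (N : ℂ) else 0) =
          if (m' : ℤ) = e + m then (N : ℂ) else 0 := by
      intro m' hm'
      rw [Finset.mem_range] at hm'
      have : (N : ℤ) ∣ e + ((m : ℤ) - m') ↔ (m' : ℤ) = e + m := by
        constructor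
        · intro h
          have := Int.eq_zero_of_abs_lt_dvd h (by
            have := abs_le.mp (le_refl |e|)
            rw [abs_lt]; constructor <;> omega)
          omega
        · intro h
          rw [h]; simp
      simp only [this]
    rw [Finset.sum_congr rfl h3]
    split_ifs with h
    · rw [Finset.sum_eq_single (e + (m : ℤ)).toNat]
      · rw [if_pos (by omega)]
      · intro b _ hb
        rw [if_neg (by omega)]
      · intro hb
        exact absurd (Finset.mem_range.mpr (by omega)) hb
    · refine Finset.sum_eq_zero fun m' hm' => ?_
      rw [Finset.mem_range] at hm'
      rw [if_neg (by omega)]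
  rw [Finset.sum_congr rfl h2, ← Finset.sum_filter, Finset.sum_const, nsmul_eq_mul, mul_comm]
  congr 2
  have : (Finset.range d).filter (fun m : ℕ => 0 ≤ e + (m : ℤ) ∧ e + (m : ℤ) < d) =
      Finset.Ico (-e).toNat (min d ((d : ℤ) - e).toNat) := by
    ext m
    simp only [Finset.mem_filter, Finset.mem_range, Finset.mem_Ico, lt_min_iff]
    omega
  rw [this, Nat.card_Ico]
  omega

/-- A Fejér-kernel quadrature for the derivative at `0`. -/
theorem sum_chebyshev_mul_fejer {d : ℕ} (hd : d ≠ 0) {j : ℕ} (hj : j ≤ d) :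
    ∑ k ∈ Finset.range (3 * d), (Polynomial.Chebyshev.T ℝ j).eval
        (Real.sin (2 * Real.pi * k / (3 * d : ℕ))) *
      (Real.sin (d * (2 * Real.pi * k / (3 * d : ℕ))) *
        fejer d (Complex.exp (2 * Real.pi * Complex.I / (3 * d : ℕ)) ^ k)) =
    (3 * d : ℕ) / 2 * (Polynomial.Chebyshev.T ℝ j).coeff 1 := by
  set N := 3 * d with hNdef
  have hN : N ≠ 0 := by omega
  set ζ := Complex.exp (2 * Real.pi * Complex.I / N)
  have hζ : IsPrimitiveRoot ζ N := Complex.isPrimitiveRoot_exp N hN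
  -- Frequencies reach j + d ≤ 2d and the kernel adds d more, hence 3d nodes. The kernel weight
  -- vanishes at j + d and equals j at j - d, which supplies the factor j of the derivative.
  have hp := sum_zpow_mul_fejer (d := d) hζ hN ((j : ℤ) + d) (by
    rw [abs_of_nonneg (by omega)]; omega)
  have hm := sum_zpow_mul_fejer (d := d) hζ hN ((j : ℤ) - d) (by
    rw [abs_of_nonpos (by omega)]; omega)
  rw [show d - ((j : ℤ) + d).natAbs = 0 by omega] at hp
  rw [show d - ((j : ℤ) - d).natAbs = j by omega] at hm
  have hexp : ∀ (k : ℕ) (e : ℤ), (ζ ^ k) ^ e =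
      Complex.exp (((e * (2 * Real.pi * k / N) : ℝ) : ℂ) * Complex.I) := by
    intro k e
    rw [← Complex.exp_nat_mul, ← Complex.exp_int_mul]
    congr 1
    push_cast
    ring
  simp_rw [hexp] at hp hm
  have hpr := congrArg Complex.re hp
  have hpi := congrArg Complex.im hp
  have hmr := congrArg Complex.re hm
  have hmi := congrArg Complex.im hm
  simp only [Complex.re_sum, Complex.im_sum, Complex.re_mul_ofReal, Complex.im_mul_ofReal,
    Complex.exp_ofReal_mul_I_re, Complex.exp_ofReal_mul_I_im] at hpr hpi hmr hmi
  simp only [Nat.cast_zero, mul_zero, Complex.zero_re, Complex.zero_im] at hpr hpi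
  rw [← Nat.cast_mul, Complex.natCast_re] at hmr
  rw [← Nat.cast_mul, Complex.natCast_im] at hmi
  -- T_j(sin t) = cos(jπ/2 - jt); multiplying by sin(dt) shifts the frequency j to j ± d.
  have key : ∀ k : ℕ, (Polynomial.Chebyshev.T ℝ j).eval (Real.sin (2 * Real.pi * k / N)) *
      (Real.sin (d * (2 * Real.pi * k / N)) * fejer d (ζ ^ k)) =
      Real.sin (j * (Real.pi / 2)) / 2 *
        (Real.cos ((((j : ℤ) - d : ℤ) : ℝ) * (2 * Real.pi * k / N)) * fejer d (ζ ^ k)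
        - Real.cos ((((j : ℤ) + d : ℤ) : ℝ) * (2 * Real.pi * k / N)) * fejer d (ζ ^ k)) +
      Real.cos (j * (Real.pi / 2)) / 2 *
        (Real.sin ((((j : ℤ) + d : ℤ) : ℝ) * (2 * Real.pi * k / N)) * fejer d (ζ ^ k)
        - Real.sin ((((j : ℤ) - d : ℤ) : ℝ) * (2 * Real.pi * k / N)) * fejer d (ζ ^ k)) := by
    intro k
    set t : ℝ := 2 * Real.pi * k / N
    rw [← Real.cos_pi_div_two_sub, Polynomial.Chebyshev.T_real_cos]
    push_cast
    rw [mul_sub, Real.cos_sub, add_mul (j : ℝ), sub_mul (j : ℝ), Real.cos_add, Real.cos_sub ((j : ℝ) * t),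
      Real.sin_add, Real.sin_sub]
    ring
  rw [Finset.sum_congr rfl fun k _ => key k, Finset.sum_add_distrib, ← Finset.mul_sum,
    ← Finset.mul_sum, Finset.sum_sub_distrib, Finset.sum_sub_distrib, hpr, hpi, hmr, hmi,
    coeff_one_chebyshev_T]
  push_cast
  ring

/-- Bernstein's inequality at the origin, with constant `2`. -/
theorem abs_coeff_one_le {d : ℕ} {M : ℝ} (p : Polynomial ℝ) (hp : p.natDegree ≤ d)
    (hM : ∀ r ∈ Set.Icc (-1 : ℝ) 1, |p.eval r| ≤ M) : |p.coeff 1| ≤ 2 * d * M := by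
  rcases eq_or_ne d 0 with rfl | hd
  · rw [Polynomial.coeff_eq_zero_of_natDegree_lt (by omega)]
    simp
  set N := 3 * d with hNdef
  have hN : N ≠ 0 := by omega
  set ζ := Complex.exp (2 * Real.pi * Complex.I / N)
  have hζ : IsPrimitiveRoot ζ N := Complex.isPrimitiveRoot_exp N hN
  let t : ℕ → ℝ := fun k => 2 * Real.pi * k / N
  -- The quadrature error, which vanishes on each T_j with j ≤ d.
  let φ : Polynomial ℝ →ₗ[ℝ] ℝ :=
    (∑ k ∈ Finset.range N, (Real.sin (d * t k) * fejer d (ζ ^ k)) •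
      Polynomial.leval (Real.sin (t k))) - ((N : ℝ) / 2) • Polynomial.lcoeff ℝ 1
  have hφ : ∀ q : Polynomial ℝ, φ q = ∑ k ∈ Finset.range N, q.eval (Real.sin (t k)) *
      (Real.sin (d * t k) * fejer d (ζ ^ k)) - (N : ℝ) / 2 * q.coeff 1 := by
    intro q
    simp [φ, LinearMap.sum_apply, mul_comm, Polynomial.leval]
  have h := eq_zero_of_chebyshev_eq_zero φ d (fun j hj => by
    rw [hφ, sub_eq_zero]
    exact sum_chebyshev_mul_fejer hd hj) p hp
  rw [hφ, sub_eq_zero] at h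
  -- The kernel has total mass N·d; dividing by N/2 produces the constant 2d.
  have hsum : ∑ k ∈ Finset.range N, fejer d (ζ ^ k) = N * d := by
    have := sum_zpow_mul_fejer (d := d) hζ hN 0 (by simp; omega)
    simp only [zpow_zero, one_mul, Int.natAbs_zero, Nat.sub_zero] at this
    exact_mod_cast this
  have hNpos : (0 : ℝ) < N := by positivity
  have : |(N : ℝ) / 2 * p.coeff 1| ≤ M * (N * d) := by
    rw [← h, ← hsum, Finset.mul_sum]
    refine (Finset.abs_sum_le_sum_abs _ _).trans (Finset.sum_le_sum fun k _ => ?_)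
    have h1 := hM _ ⟨Real.neg_one_le_sin (t k), Real.sin_le_one (t k)⟩
    have hM0 : 0 ≤ M := (abs_nonneg _).trans h1
    rw [abs_mul, abs_mul, abs_of_nonneg (fejer_nonneg _ _)]
    refine mul_le_mul h1 ?_ (mul_nonneg (abs_nonneg _) (fejer_nonneg _ _)) hM0
    exact mul_le_of_le_one_left (fejer_nonneg _ _) (Real.abs_sin_le_one _)
  rw [abs_mul, abs_of_pos (by positivity)] at this
  refine le_of_mul_le_mul_left (this.trans_eq ?_) (half_pos hNpos)
  ring

/-! ### Riesz products and Khintchine's inequality -/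

theorem sum_prod_cube {R : Type*} [CommSemiring R] {n : ℕ} (g : Fin n → ℤˣ → R) :
    ∑ x : Cube n, ∏ j, g j (x j) = ∏ j, (g j 1 + g j (-1)) := by
  have hu : (Finset.univ : Finset ℤˣ) = {1, -1} := rfl
  have e := Finset.prod_univ_sum (fun _ : Fin n => (Finset.univ : Finset ℤˣ)) g
  rw [Fintype.piFinset_univ] at e
  rw [← e]
  refine Finset.prod_congr rfl fun j _ => ?_
  rw [hu, Finset.sum_pair (by decide)]

/-- The linear Fourier coefficients of a Riesz product. -/
theorem sum_coord_mul_riesz {n : ℕ} (b : Fin n → ℝ) (j : Fin n) :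
    ∑ x : Cube n, (((x j : ℤˣ) : ℤ) : ℂ) * ∏ k, (1 + (b k * (((x k : ℤˣ) : ℤ) : ℝ) : ℝ) * Complex.I)
      = 2 ^ n * (b j * Complex.I) := by
  have h : ∀ x : Cube n,
      (((x j : ℤˣ) : ℤ) : ℂ) * ∏ k, (1 + (b k * (((x k : ℤˣ) : ℤ) : ℝ) : ℝ) * Complex.I) =
      ∏ k, ((if k = j then (((x k : ℤˣ) : ℤ) : ℂ) else 1) *
        (1 + (b k * (((x k : ℤˣ) : ℤ) : ℝ) : ℝ) * Complex.I)) := by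
    intro x
    rw [Finset.prod_mul_distrib, Finset.prod_ite_eq' Finset.univ j]
    simp
  rw [Finset.sum_congr rfl fun x _ => h x,
    sum_prod_cube fun k u => (if k = j then ((u : ℤ) : ℂ) else 1) *
      (1 + (b k * ((u : ℤ) : ℝ) : ℝ) * Complex.I)]
  have h2 : ∀ k, ((if k = j then (((1 : ℤˣ) : ℤ) : ℂ) else 1) *
      (1 + (b k * (((1 : ℤˣ) : ℤ) : ℝ) : ℝ) * Complex.I) +
      (if k = j then (((-1 : ℤˣ) : ℤ) : ℂ) else 1) *
      (1 + (b k * (((-1 : ℤˣ) : ℤ) : ℝ) : ℝ) * Complex.I)) =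
      2 * if k = j then b k * Complex.I else 1 := by
    intro k
    split_ifs <;> push_cast <;> ring
  rw [Finset.prod_congr rfl fun k _ => h2 k, Finset.prod_mul_distrib,
    Finset.prod_ite_eq' Finset.univ j]
  simp

/-- Because the perturbation is imaginary, each factor has modulus √(1 + b²) ≤ e^(b²/2), with no
first-order growth. -/
theorem norm_riesz_le {n : ℕ} (b : Fin n → ℝ) (x : Cube n) :
    ‖∏ k, (1 + (b k * (((x k : ℤˣ) : ℤ) : ℝ) : ℝ) * Complex.I)‖ ≤
      Real.exp ((∑ k, b k ^ 2) / 2) := by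
  rw [norm_prod, Finset.sum_div, Real.exp_sum]
  refine Finset.prod_le_prod (fun _ _ => norm_nonneg _) fun k _ => ?_
  have hx : ((((x k : ℤˣ) : ℤ) : ℝ)) ^ 2 = 1 := by
    rcases Int.units_eq_one_or (x k) with h | h <;> simp [h]
  have h1 : ‖(1 : ℂ) + (b k * (((x k : ℤˣ) : ℤ) : ℝ) : ℝ) * Complex.I‖ = √(1 + b k ^ 2) := by
    have := Complex.norm_add_mul_I 1 (b k * (((x k : ℤˣ) : ℤ) : ℝ))
    rw [mul_pow, hx, one_pow, mul_one] at this
    rw [← this]; simp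
  rw [h1]
  apply Real.sqrt_le_iff.mpr ⟨(Real.exp_pos _).le, ?_⟩
  rw [← Real.exp_nat_mul, add_comm]
  convert Real.add_one_le_exp (b k ^ 2) using 2
  push_cast; ring

/-- The `L¹`-`L²` Khintchine inequality with constant `√e`. -/
theorem khintchine {n : ℕ} (a : Fin n → ℝ) :
    2 ^ n * √(∑ j, a j ^ 2) ≤
      Real.exp (1 / 2) * ∑ x : Cube n, |∑ j, a j * (((x j : ℤˣ) : ℤ) : ℝ)| := by
  set σ := √(∑ j, a j ^ 2) with hσ
  have hs0 : 0 ≤ ∑ j, a j ^ 2 := Finset.sum_nonneg fun _ _ => sq_nonneg _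
  have hσ2 : σ ^ 2 = ∑ j, a j ^ 2 := Real.sq_sqrt hs0
  rcases (Real.sqrt_nonneg (∑ j, a j ^ 2)).eq_or_lt with h0 | hpos
  · rw [hσ, ← h0, mul_zero]
    exact mul_nonneg (Real.exp_pos _).le (Finset.sum_nonneg fun _ _ => abs_nonneg _)
  rw [← hσ] at hpos
  have hb2 : ∑ k, (a k / σ) ^ 2 = 1 := by
    simp_rw [div_pow]
    rw [← Finset.sum_div, ← hσ2, div_self (by positivity)]
  -- Dual test function: normalising by `σ` makes it bounded by √e, while its pairing with the
  -- linear form is 2^n·σ·i.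
  let P : Cube n → ℂ := fun x => ∏ k, (1 + (a k / σ * (((x k : ℤˣ) : ℤ) : ℝ) : ℝ) * Complex.I)
  have hP : ∀ x, ‖P x‖ ≤ Real.exp (1 / 2) := fun x => by
    have := norm_riesz_le (fun k => a k / σ) x
    rwa [hb2] at this
  have hmain : ∑ x : Cube n, ((∑ j, a j * (((x j : ℤˣ) : ℤ) : ℝ) : ℝ) : ℂ) * P x =
      ((2 ^ n * σ : ℝ) : ℂ) * Complex.I := by
    have h1 : ∀ x : Cube n, ((∑ j, a j * (((x j : ℤˣ) : ℤ) : ℝ) : ℝ) : ℂ) * P x =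
        ∑ j, (a j : ℂ) * ((((x j : ℤˣ) : ℤ) : ℂ) * P x) := by
      intro x
      push_cast
      rw [Finset.sum_mul]
      exact Finset.sum_congr rfl fun j _ => mul_assoc _ _ _
    rw [Finset.sum_congr rfl fun x _ => h1 x, Finset.sum_comm]
    simp_rw [← Finset.mul_sum, P]
    have h2 : ∀ j, (a j : ℂ) * ∑ x : Cube n, ((((x j : ℤˣ) : ℤ) : ℂ) *
        ∏ k, (1 + (a k / σ * (((x k : ℤˣ) : ℤ) : ℝ) : ℝ) * Complex.I)) =
        ((2 ^ n * (a j ^ 2 / σ) : ℝ) : ℂ) * Complex.I := by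
      intro j
      rw [sum_coord_mul_riesz (fun k => a k / σ) j]
      push_cast
      ring
    rw [Finset.sum_congr rfl fun j _ => h2 j, ← Finset.sum_mul, ← Complex.ofReal_sum,
      ← Finset.mul_sum, ← Finset.sum_div, ← hσ2]
    congr 3
    field_simp
  have hn := congrArg norm hmain
  rw [norm_mul, Complex.norm_I, mul_one, Complex.norm_real, Real.norm_of_nonneg (by positivity)]
    at hn
  rw [← hn, Finset.mul_sum]
  refine (norm_sum_le _ _).trans (Finset.sum_le_sum fun x _ => ?_)
  rw [norm_mul, Complex.norm_real, Real.norm_eq_abs, mul_comm]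
  exact mul_le_mul_of_nonneg_right (hP x) (abs_nonneg _)

theorem two_pow_mul_sum_abs_le {n : ℕ} (a : Fin n → ℝ) :
    2 ^ n * ∑ j, |a j| ≤
      √n * Real.exp (1 / 2) * ∑ x : Cube n, |∑ j, a j * (((x j : ℤˣ) : ℤ) : ℝ)| := by
  have h : ∑ j, |a j| ≤ √n * √(∑ j, a j ^ 2) := by
    rw [← Real.sqrt_mul (Nat.cast_nonneg n)]
    apply Real.le_sqrt_of_sq_le
    have := sq_sum_le_card_mul_sum_sq (s := Finset.univ) (f := fun j => |a j|)
    simpa using this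
  calc 2 ^ n * ∑ j, |a j| ≤ 2 ^ n * (√n * √(∑ j, a j ^ 2)) := by gcongr
    _ = √n * (2 ^ n * √(∑ j, a j ^ 2)) := by ring
    _ ≤ √n * (Real.exp (1 / 2) * ∑ x : Cube n, |∑ j, a j * (((x j : ℤˣ) : ℤ) : ℝ)|) :=
        mul_le_mul_of_nonneg_left (khintchine a) (Real.sqrt_nonneg _)
    _ = _ := by ring

/-! ### The multilinear extension, its recentrings and its restrictions to lines -/

/-- The partial derivative along `T` of the multilinear extension of `f` to `ℝⁿ`. -/
noncomputable def extDeriv {n : ℕ} (f : Cube n → ℝ) (T : Finset (Fin n)) (x : Fin n → ℝ) : ℝ :=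
  ∑ S with T ⊆ S, fourierCoeff f S * ∏ j ∈ S \ T, x j

/-- On [-1,1]^n this is the mean of f under the product measure with mean x, which is why the bound
on f carries over. -/
theorem extDeriv_empty_eq {n : ℕ} (f : Cube n → ℝ) (x : Fin n → ℝ) :
    extDeriv f ∅ x = (∑ y : Cube n, f y * ∏ j, (1 + x j * (((y j : ℤˣ) : ℤ) : ℝ))) / 2 ^ n := by
  simp only [extDeriv, Finset.empty_subset, Finset.filter_true, Finset.sdiff_empty, fourierCoeff]
  simp_rw [div_mul_eq_mul_div, Finset.sum_mul]
  rw [← Finset.sum_div, Finset.sum_comm]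
  congr 1
  refine Finset.sum_congr rfl fun y _ => ?_
  rw [Finset.prod_one_add, Finset.powerset_univ, Finset.mul_sum]
  refine Finset.sum_congr rfl fun S _ => ?_
  rw [Finset.prod_mul_distrib, chi]
  ring

theorem abs_extDeriv_empty_le {n : ℕ} {f : Cube n → ℝ} (hf : ∀ x, |f x| ≤ 1) {x : Fin n → ℝ}
    (hx : ∀ j, |x j| ≤ 1) : |extDeriv f ∅ x| ≤ 1 := by
  have hw : ∀ y : Cube n, 0 ≤ ∏ j, (1 + x j * (((y j : ℤˣ) : ℤ) : ℝ)) := fun y =>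
    Finset.prod_nonneg fun j _ => by
      have := abs_le.mp (hx j)
      rcases Int.units_eq_one_or (y j) with h | h <;> simp [h] <;> linarith
  have hsum : ∑ y : Cube n, ∏ j, (1 + x j * (((y j : ℤˣ) : ℤ) : ℝ)) = 2 ^ n := by
    rw [sum_prod_cube fun j u => 1 + x j * ((u : ℤ) : ℝ)]
    rw [Finset.prod_congr rfl (g := fun _ => (2 : ℝ)) fun j _ => by push_cast; ring]
    simp
  rw [extDeriv_empty_eq, abs_div, abs_of_pos (by positivity : (0 : ℝ) < 2 ^ n),
    div_le_one (by positivity), ← hsum]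
  refine (Finset.abs_sum_le_sum_abs _ _).trans (Finset.sum_le_sum fun y _ => ?_)
  rw [abs_mul, abs_of_nonneg (hw y)]
  exact mul_le_of_le_one_left (hw y) (hf y)

/-- Recentring the multilinear extension at `x` with scale `ρ`. -/
theorem fourierCoeff_recentre {n : ℕ} (f : Cube n → ℝ) (x : Fin n → ℝ) (ρ : ℝ)
    (T : Finset (Fin n)) :
    fourierCoeff (fun y => extDeriv f ∅ fun j => ρ * (((y j : ℤˣ) : ℤ) : ℝ) + x j) T =
      ρ ^ T.card * extDeriv f T x := by
  refine fourierCoeff_unique _ (fun T => ρ ^ T.card * extDeriv f T x) (fun y => ?_) T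
  simp only [extDeriv, Finset.empty_subset, Finset.filter_true, Finset.sdiff_empty]
  simp_rw [Finset.prod_add, Finset.prod_mul_distrib, Finset.prod_const, Finset.mul_sum,
    Finset.sum_mul, Finset.sum_filter]
  rw [Finset.sum_comm]
  refine Finset.sum_congr rfl fun S _ => ?_
  rw [← Finset.sum_filter]
  refine Finset.sum_congr (by ext; simp) fun T _ => ?_
  rw [chi]
  ring

theorem degree_recentre_le {n d : ℕ} {f : Cube n → ℝ} (hd : degree f ≤ d) (x : Fin n → ℝ)
    (ρ : ℝ) :
    degree (fun y => extDeriv f ∅ fun j => ρ * (((y j : ℤˣ) : ℤ) : ℝ) + x j) ≤ d := by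
  rw [degree_le_iff] at hd ⊢
  intro T hT
  rw [fourierCoeff_recentre, extDeriv, Finset.sum_eq_zero, mul_zero]
  intro S hS
  rw [hd S (hT.trans_le (Finset.card_le_card (Finset.mem_filter.mp hS).2)), zero_mul]

/-- The restriction of `extDeriv f T` to the line spanned by `x`, as a polynomial. -/
noncomputable def linePoly {n : ℕ} (f : Cube n → ℝ) (T : Finset (Fin n)) (x : Cube n) :
    Polynomial ℝ :=
  ∑ S with T ⊆ S, Polynomial.monomial (S \ T).card (fourierCoeff f S * chi (S \ T) x)

theorem eval_linePoly {n : ℕ} (f : Cube n → ℝ) (T : Finset (Fin n)) (x : Cube n) (r : ℝ) :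
    (linePoly f T x).eval r = extDeriv f T fun j => r * (((x j : ℤˣ) : ℤ) : ℝ) := by
  rw [linePoly, Polynomial.eval_finsetSum, extDeriv]
  refine Finset.sum_congr rfl fun S _ => ?_
  rw [Polynomial.eval_monomial, Finset.prod_mul_distrib, Finset.prod_const, chi]
  ring

theorem natDegree_linePoly_le {n d : ℕ} {f : Cube n → ℝ} (hd : degree f ≤ d)
    (T : Finset (Fin n)) (x : Cube n) : (linePoly f T x).natDegree ≤ d := by
  refine Polynomial.natDegree_sum_le_of_forall_le _ _ fun S _ => ?_
  by_cases hS : d < S.card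
  · rw [(degree_le_iff f d).mp hd S hS]
    simp
  · exact (Polynomial.natDegree_monomial_le _).trans
      ((Finset.card_le_card Finset.sdiff_subset).trans (not_lt.mp hS))

/-- A linear form in the signs x, so Khintchine applies to what Bernstein controls. -/
theorem coeff_one_linePoly {n : ℕ} (f : Cube n → ℝ) (T : Finset (Fin n)) (x : Cube n) :
    (linePoly f T x).coeff 1 =
      ∑ j, (if j ∈ T then 0 else fourierCoeff f (insert j T)) * (((x j : ℤˣ) : ℤ) : ℝ) := by
  rw [linePoly, Polynomial.finsetSum_coeff]
  simp_rw [Polynomial.coeff_monomial, ite_mul, zero_mul]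
  rw [← Finset.sum_filter, Finset.filter_filter, Finset.sum_ite, Finset.sum_const_zero, zero_add]
  symm
  refine Finset.sum_bij (fun j _ => insert j T) ?_ ?_ ?_ ?_
  · intro j hj
    simp only [Finset.mem_filter, Finset.mem_univ, true_and] at hj ⊢
    exact ⟨Finset.subset_insert _ _, by simp [Finset.insert_sdiff_of_notMem _ hj]⟩
  · intro i hi j hj h
    simp only [Finset.mem_filter, Finset.mem_univ, true_and] at hi hj
    have : i ∈ insert j T := h ▸ Finset.mem_insert_self i T
    exact (Finset.mem_insert.mp this).resolve_right hi
  · intro S hS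
    simp only [Finset.mem_filter, Finset.mem_univ, true_and] at hS
    obtain ⟨j, hj⟩ := Finset.card_eq_one.mp hS.2
    have hj' : j ∈ S \ T := by rw [hj]; simp
    refine ⟨j, by simpa using (Finset.mem_sdiff.mp hj').2, ?_⟩
    rw [Finset.insert_eq, ← hj, Finset.sdiff_union_of_subset hS.1]
  · intro j hj
    simp only [Finset.mem_filter, Finset.mem_univ, true_and] at hj
    simp [Finset.insert_sdiff_of_notMem _ hj, chi]

/-! ### Level one and the inductive step -/

theorem levelL1Norm_one_le {n d : ℕ} {f : Cube n → ℝ} (hf : ∀ x, |f x| ≤ 1)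
    (hd : degree f ≤ d) : levelL1Norm f 1 ≤ 2 * d := by
  let x : Cube n := fun j => if 0 ≤ fourierCoeff f {j} then 1 else -1
  have h := abs_coeff_one_le (M := 1) (linePoly f ∅ x) (natDegree_linePoly_le hd ∅ x) (by
    intro r hr
    rw [eval_linePoly]
    refine abs_extDeriv_empty_le hf fun j => ?_
    rw [abs_mul]
    have : |(((x j : ℤˣ) : ℤ) : ℝ)| = 1 := by
      rcases Int.units_eq_one_or (x j) with h | h <;> simp [h]
    rw [this, mul_one]
    exact abs_le.mpr hr)
  rw [coeff_one_linePoly, mul_one] at h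
  refine le_trans (le_of_eq ?_) ((le_abs_self _).trans h)
  rw [levelL1Norm, Finset.powersetCard_one, Finset.sum_map]
  refine Finset.sum_congr rfl fun j _ => ?_
  by_cases hj : 0 ≤ fourierCoeff f {j}
  · simp [x, hj, abs_of_nonneg hj]
  · simp [x, hj, abs_of_neg (not_le.mp hj)]

/-- For |x_j| ≤ 1/2 the points x + y/2 stay in [-1,1]^n, so `hB` applies to the recentred function,
whose level-`l` coefficients are 2^(-l)·∂_T F(x). -/
theorem sum_abs_extDeriv_le {n d l : ℕ} {B : ℝ}
    (hB : ∀ g : Cube n → ℝ, (∀ x, |g x| ≤ 1) → degree g ≤ d → levelL1Norm g l ≤ B)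
    {f : Cube n → ℝ} (hf : ∀ x, |f x| ≤ 1) (hd : degree f ≤ d) {x : Fin n → ℝ}
    (hx : ∀ j, |x j| ≤ 1 / 2) :
    ∑ T ∈ (Finset.univ : Finset (Fin n)).powersetCard l, |extDeriv f T x| ≤ 2 ^ l * B := by
  have h := hB _ (fun y => abs_extDeriv_empty_le hf
    (x := fun j => 1 / 2 * (((y j : ℤˣ) : ℤ) : ℝ) + x j) fun j => by
      have := abs_le.mp (hx j)
      rw [abs_le]
      rcases Int.units_eq_one_or (y j) with h | h <;> simp [h] <;>
        constructor <;> linarith) (degree_recentre_le hd x (1 / 2))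
  rw [levelL1Norm] at h
  have h2 : ∑ T ∈ (Finset.univ : Finset (Fin n)).powersetCard l,
      |fourierCoeff (fun y => extDeriv f ∅ fun j => 1 / 2 * (((y j : ℤˣ) : ℤ) : ℝ) + x j) T| =
      (1 / 2) ^ l * ∑ T ∈ (Finset.univ : Finset (Fin n)).powersetCard l, |extDeriv f T x| := by
    rw [Finset.mul_sum]
    refine Finset.sum_congr rfl fun T hT => ?_
    rw [fourierCoeff_recentre, abs_mul, abs_of_pos (by positivity),
      (Finset.mem_powersetCard.mp hT).2]
  rw [h2] at h
  calc _ = 2 ^ l * ((1 / 2) ^ l *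
        ∑ T ∈ (Finset.univ : Finset (Fin n)).powersetCard l, |extDeriv f T x|) := by
        rw [← mul_assoc, ← mul_pow]; norm_num
    _ ≤ _ := by gcongr

/-- Double counting of pairs (S, j) with j ∈ S, via T = S \ {j}. -/
theorem sum_powersetCard_succ_mul {n : ℕ} (l : ℕ) (a : Finset (Fin n) → ℝ) :
    ((l : ℝ) + 1) * ∑ S ∈ (Finset.univ : Finset (Fin n)).powersetCard (l + 1), a S =
      ∑ T ∈ (Finset.univ : Finset (Fin n)).powersetCard l,
        ∑ j, if j ∈ T then 0 else a (insert j T) := by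
  have h1 : ((l : ℝ) + 1) * ∑ S ∈ (Finset.univ : Finset (Fin n)).powersetCard (l + 1), a S =
      ∑ S ∈ (Finset.univ : Finset (Fin n)).powersetCard (l + 1), ∑ j ∈ S, a S := by
    rw [Finset.mul_sum]
    refine Finset.sum_congr rfl fun S hS => ?_
    rw [Finset.sum_const, (Finset.mem_powersetCard.mp hS).2, nsmul_eq_mul]
    push_cast; ring
  have h2 : ∀ T : Finset (Fin n), ∑ j, (if j ∈ T then 0 else a (insert j T)) =
      ∑ j ∈ Tᶜ, a (insert j T) := by
    intro T
    rw [Finset.sum_ite, Finset.sum_const_zero, zero_add]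
    exact Finset.sum_congr (by ext; simp) fun _ _ => rfl
  simp_rw [h1, h2]
  rw [Finset.sum_sigma', Finset.sum_sigma']
  refine Finset.sum_bij' (fun p _ => ⟨p.1.erase p.2, p.2⟩) (fun p _ => ⟨insert p.2 p.1, p.2⟩)
    ?_ ?_ ?_ ?_ ?_
  · rintro ⟨S, j⟩ h
    simp only [Finset.mem_sigma, Finset.mem_powersetCard_univ] at h
    simp [Finset.card_erase_of_mem h.2, h.1]
  · rintro ⟨T, j⟩ h
    simp only [Finset.mem_sigma, Finset.mem_powersetCard_univ, Finset.mem_compl] at h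
    simp [Finset.card_insert_of_notMem h.2, h.1]
  · rintro ⟨S, j⟩ h
    simp only [Finset.mem_sigma, Finset.mem_powersetCard_univ] at h
    simp [Finset.insert_erase h.2]
  · rintro ⟨T, j⟩ h
    simp only [Finset.mem_sigma, Finset.mem_powersetCard_univ, Finset.mem_compl] at h
    simp [Finset.erase_insert h.2]
  · rintro ⟨S, j⟩ h
    simp only [Finset.mem_sigma, Finset.mem_powersetCard_univ] at h
    simp [Finset.insert_erase h.2]

/-- Bernstein's inequality for a finite family of polynomials, in `ℓ¹`. -/
theorem sum_abs_coeff_one_le {ι : Type*} {s : Finset ι} {d : ℕ} {M : ℝ} (p : ι → Polynomial ℝ)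
    (hp : ∀ i ∈ s, (p i).natDegree ≤ d)
    (hM : ∀ r : ℝ, |r| ≤ 1 / 2 → ∑ i ∈ s, |(p i).eval r| ≤ M) :
    ∑ i ∈ s, |(p i).coeff 1| ≤ 4 * d * M := by
  -- The signs turn the ℓ¹ sum into one linear coefficient. Composing with X/2 stretches [-1/2, 1/2]
  -- to [-1, 1] and doubles Bernstein's constant to 4.
  let q : Polynomial ℝ := ∑ i ∈ s, Polynomial.C (SignType.sign ((p i).coeff 1) : ℝ) * p i
  have hsgn : ∀ a : ℝ, |((SignType.sign a : SignType) : ℝ)| ≤ 1 := fun a => by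
    rcases lt_trichotomy a 0 with h | h | h <;> simp [h]
  have hq : (q.comp (Polynomial.C (1 / 2) * Polynomial.X)).natDegree ≤ d := by
    have h1 : q.natDegree ≤ d := Polynomial.natDegree_sum_le_of_forall_le _ _ fun i hi =>
      (Polynomial.natDegree_C_mul_le _ _).trans (hp i hi)
    rw [Polynomial.natDegree_comp]
    refine (Nat.mul_le_mul h1 ?_).trans_eq (mul_one d)
    exact (Polynomial.natDegree_C_mul_le _ _).trans Polynomial.natDegree_X_le
  have h := abs_coeff_one_le (M := M) _ hq (by
    intro r hr
    have h2 : |1 / 2 * r| ≤ 1 / 2 := by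
      rw [abs_mul, abs_of_pos (by norm_num)]
      have := abs_le.mpr hr
      linarith
    simp only [Polynomial.eval_comp, Polynomial.eval_mul, Polynomial.eval_C, Polynomial.eval_X, q,
      Polynomial.eval_finsetSum]
    refine (Finset.abs_sum_le_sum_abs _ _).trans ((Finset.sum_le_sum fun i _ => ?_).trans
      (hM _ h2))
    rw [abs_mul]
    exact mul_le_of_le_one_left (abs_nonneg _) (hsgn _))
  have hc : q.coeff 1 = ∑ i ∈ s, |(p i).coeff 1| := by
    simp [q, sign_mul_self]
  rw [Polynomial.comp_C_mul_X_coeff, hc] at h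
  have := (le_abs_self _).trans h
  linarith

theorem levelL1Norm_succ_le {n d l : ℕ} {B : ℝ}
    (hB : ∀ g : Cube n → ℝ, (∀ x, |g x| ≤ 1) → degree g ≤ d → levelL1Norm g l ≤ B)
    {f : Cube n → ℝ} (hf : ∀ x, |f x| ≤ 1) (hd : degree f ≤ d) :
    ((l : ℝ) + 1) * levelL1Norm f (l + 1) ≤
      √n * Real.exp (1 / 2) * (4 * d * (2 ^ l * B)) := by
  set 𝒯 := (Finset.univ : Finset (Fin n)).powersetCard l
  -- One application covers all pairs (T, x); the factor 2^n in `M` comes from summing over x and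
  -- cancels against Khintchine's normalisation.
  have hbern := sum_abs_coeff_one_le (s := 𝒯 ×ˢ (Finset.univ : Finset (Cube n))) (d := d)
    (M := 2 ^ n * (2 ^ l * B)) (fun i => linePoly f i.1 i.2)
    (fun i _ => natDegree_linePoly_le hd _ _) (by
      intro r hr
      rw [Finset.sum_product_right]
      have : ∀ x ∈ (Finset.univ : Finset (Cube n)),
          ∑ T ∈ 𝒯, |(linePoly f T x).eval r| ≤ 2 ^ l * B := by
        intro x _
        simp_rw [eval_linePoly]
        refine sum_abs_extDeriv_le hB hf hd fun j => ?_
        rcases Int.units_eq_one_or (x j) with h | h <;> simpa [h] using hr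
      refine (Finset.sum_le_card_nsmul _ _ _ this).trans_eq ?_
      simp)
  rw [Finset.sum_product] at hbern
  have hkh : 2 ^ n * (((l : ℝ) + 1) * levelL1Norm f (l + 1)) ≤
      √n * Real.exp (1 / 2) * ∑ T ∈ 𝒯, ∑ x : Cube n, |(linePoly f T x).coeff 1| := by
    rw [levelL1Norm, sum_powersetCard_succ_mul, Finset.mul_sum, Finset.mul_sum]
    refine Finset.sum_le_sum fun T _ => ?_
    have := two_pow_mul_sum_abs_le fun j => if j ∈ T then 0 else fourierCoeff f (insert j T)
    simp_rw [coeff_one_linePoly]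
    refine le_trans (le_of_eq ?_) this
    congr 1
    refine Finset.sum_congr rfl fun j _ => ?_
    split_ifs <;> simp
  have h2 : (0 : ℝ) < 2 ^ n := by positivity
  refine le_of_mul_le_mul_left ?_ h2
  calc _ ≤ _ := hkh
    _ ≤ √n * Real.exp (1 / 2) * (4 * d * (2 ^ n * (2 ^ l * B))) := by gcongr
    _ = _ := by ring

/-! ### Constants and conclusion -/

theorem four_mul_two_pow_mul_exp_half_le {l : ℕ} (hl : 1 ≤ l) :
    4 * 2 ^ l * Real.exp (1 / 2) ≤ ((l : ℝ) + 1) * Real.exp (l + 1) := by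
  have he : 2 ≤ Real.exp 1 := by have := Real.exp_one_gt_d9; linarith
  have hh : 0 < Real.exp (1 / 2) := Real.exp_pos _
  induction l, hl using Nat.le_induction with
  | base =>
    have h2 : Real.exp ((1 : ℕ) + 1) = Real.exp (1 / 2) * (Real.exp (1 / 2) * Real.exp 1) := by
      rw [← Real.exp_add, ← Real.exp_add]; norm_num
    have h3 : Real.exp (1 / 2) * Real.exp 1 ≥ 4 := by
      have h5 : 1.6 ≤ Real.exp (1 / 2) := by
        have h6 : Real.exp 1 = Real.exp (1 / 2) ^ 2 := by
          rw [← Real.exp_nat_mul]; norm_num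
        have := Real.exp_one_gt_d9
        nlinarith
      have := Real.exp_one_gt_d9
      nlinarith
    rw [h2]
    push_cast
    nlinarith
  | succ l hl ih =>
    have h1 : Real.exp ((l + 1 : ℕ) + 1) = Real.exp (l + 1) * Real.exp 1 := by
      rw [← Real.exp_add]; push_cast; rfl
    rw [h1, pow_succ]
    push_cast
    have hp : 0 < Real.exp ((l : ℝ) + 1) := Real.exp_pos _
    have hl0 : (0 : ℝ) ≤ l := Nat.cast_nonneg l
    calc 4 * (2 ^ l * 2) * Real.exp (1 / 2) = 2 * (4 * 2 ^ l * Real.exp (1 / 2)) := by ring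
      _ ≤ 2 * (((l : ℝ) + 1) * Real.exp (l + 1)) := by gcongr
      _ = ((l : ℝ) + 1) * (Real.exp (l + 1) * 2) := by ring
      _ ≤ ((l : ℝ) + 1 + 1) * (Real.exp (l + 1) * Real.exp 1) := by gcongr; linarith

theorem levelL1Norm_le {n d l : ℕ} (hl : 1 ≤ l) {f : Cube n → ℝ} (hf : ∀ x, |f x| ≤ 1)
    (hd : degree f ≤ d) :
    levelL1Norm f l ≤ √n ^ (l - 1) * (d : ℝ) ^ l * Real.exp ((l + 1).choose 2 : ℕ) := by
  induction l, hl using Nat.le_induction generalizing f with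
  | base =>
    refine (levelL1Norm_one_le hf hd).trans ?_
    have he : 2 ≤ Real.exp 1 := by have := Real.exp_one_gt_d9; linarith
    have hd0 : (0 : ℝ) ≤ d := Nat.cast_nonneg d
    simp
    nlinarith
  | succ l hl ih =>
    have h := levelL1Norm_succ_le (fun g hg hgd => ih hg hgd) hf hd
    have hpos : (0 : ℝ) < (l : ℝ) + 1 := by positivity
    refine le_of_mul_le_mul_left (h.trans ?_) hpos
    -- Pascal's rule: passing from `l` to `l + 1` leaves exactly a factor e^(l+1) for the constants.
    have hexp : Real.exp ((l + 1 + 1).choose 2 : ℕ) =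
        Real.exp (l + 1) * Real.exp ((l + 1).choose 2 : ℕ) := by
      rw [← Real.exp_add, Nat.choose_succ_succ' (l + 1) 1, Nat.choose_one_right]
      push_cast; rfl
    have hsq : √(n : ℝ) ^ (l + 1 - 1) = √n ^ (l - 1) * √n := by
      rw [← pow_succ]; congr 1; omega
    rw [hexp, hsq, pow_succ (d : ℝ)]
    calc _ = (√n ^ (l - 1) * √n * ((d : ℝ) ^ l * d) * Real.exp ((l + 1).choose 2 : ℕ)) *
          (4 * 2 ^ l * Real.exp (1 / 2)) := by ring
      _ ≤ (√n ^ (l - 1) * √n * ((d : ℝ) ^ l * d) * Real.exp ((l + 1).choose 2 : ℕ)) *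
          (((l : ℝ) + 1) * Real.exp (l + 1)) :=
          mul_le_mul_of_nonneg_left (four_mul_two_pow_mul_exp_half_le hl) (by positivity)
      _ = _ := by ring

end BooleanCube

theorem theorem2 (n d l : ℕ) (hl : 1 ≤ l) (f : BooleanCube.Cube n → ℝ)
    (hf : ∀ x, f x ∈ Set.Icc (-1 : ℝ) 1) (hd : BooleanCube.degree f ≤ d) :
    BooleanCube.levelL1Norm f l ≤
      (n : ℝ) ^ (((l : ℝ) - 1) / 2) * (d : ℝ) ^ l * Real.exp ((Nat.choose (l + 1) 2 : ℕ) : ℝ) := by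
  have h := BooleanCube.levelL1Norm_le hl (fun x => abs_le.mpr (hf x)) hd
  have hn : √(n : ℝ) ^ (l - 1) = (n : ℝ) ^ (((l : ℝ) - 1) / 2) := by
    rw [Real.sqrt_eq_rpow, ← Real.rpow_natCast, ← Real.rpow_mul (Nat.cast_nonneg n),
      Nat.cast_sub hl]
    congr 1
    push_cast
    ring
  rwa [hn] at h
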